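/- **Conventions.** All systems are finite-dimensional: a system $X$ is a Hilbert space $\mathbb{C}^{d_X}$. A state is a positive semidefinite matrix of trace one; a channel is a completely positive trace-preserving linear map on matrices. Let $G$ be a connected Lie group. A $G$-action on $X$ is a continuous, possibly projective, unitary representation $g\mapsto U_g^X$ (i.e. $U^X_{gh}=c\,U^X_gU^X_h$ with $|c|=1$, and $g\mapsto U_g^X A (U_g^X)^\dagger$ is continuous for every matrix $A$). A state $\rho$ of $X$ is $G$-symmetric if $U_g^X\rho (U_g^X)^\dagger=\rho$ for all $g\in G$, and $G$-asymmetric otherwise. On $RS=R\otimes S$ the group acts by $U_g^R\otimes U_g^S$, and a channel $\mathcal{E}$ on $RS$ is $G$-covariant if it commutes with $A\mapsto (U_g^R\otimes U_g^S)A(U_g^R\otimes U_g^S)^\dagger$ for every $g$. We write $\rho_R|\rho'_S$ for any (possibly correlated) state of $RS$ with marginals $\rho_R$ on $R$ and $\rho'_S$ on $S$. $R$ *can weakly broadcast $G$-asymmetry* if there exist a system $S$ with a $G$-action, a $G$-symmetric state $\rho_S$ of $S$, a $G$-asymmetric state $\rho'_S$ of $S$, a sequence $(\mathcal{E}^{(n)})_{n\in\mathbb{N}}$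 of $G$-covariant channels on $RS$, and a sequence $(\rho_R^{(n)})_{n\in\mathbb{N}}$ of states of $R$ such that for every $n\in\mathbb{N}$ $$\mathcal{E}^{(n)}\bigl(\rho_R^{(n)}\otimes\rho_S\bigr)=\rho_R^{(n+1)}|\rho'_S .$$ $R$ with Hamiltonian $H_R$ *can weakly broadcast coherence* if the same holds for $G=\mathbb{R}$ acting by time translations $e^{-itH_R}$ on $R$ and $e^{-itH_S}$ on $S$, for some Hamiltonian (Hermitian matrix) $H_S$ of $S$; here $[\rho_S,H_S]=0$ and $[\rho'_S,H_S]\neq0$ express symmetry of $\rho_S$ and asymmetry of $\rho'_S$. **Theorem.** Let $R$ be a finite-dimensional system. 1. For every connected Lie group $G$ and every $G$-action on $R$, the system $R$ cannot weakly broadcast $G$-asymmetry. 2. For every Hamiltonian $H_R$ on $R$, the system $R$ cannot weakly broadcast coherence. -/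

import Mathlib

open scoped Matrix Kronecker ContDiff Manifold ComplexOrder

namespace QBroadcast

/-- A density matrix on the Hilbert space `ℂ^n`: positive semidefinite, of trace one. -/
def IsState {n : Type*} [Fintype n] (ρ : Matrix n n ℂ) : Prop :=
  ρ.PosSemidef ∧ ρ.trace = 1

/-- Partial trace over the second tensor factor `S` of `R ⊗ S`. -/
def traceS {r s : Type*} [Fintype s] (X : Matrix (r × s) (r × s) ℂ) : Matrix r r ℂ :=
  Matrix.of fun i j => ∑ a, X (i, a) (j, a)

/-- Partial trace over the first tensor factor `R` of `R ⊗ S`. -/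
def traceR {r s : Type*} [Fintype r] (X : Matrix (r × s) (r × s) ℂ) : Matrix s s ℂ :=
  Matrix.of fun a b => ∑ i, X (i, a) (i, b)

/-- `IsJoint σ ρR ρS` says that the bipartite operator `σ` is of the form `ρR|ρS`: it has the
marginals `ρR` and `ρS`, and is otherwise arbitrary (correlated, or even entangled). -/
def IsJoint {r s : Type*} [Fintype r] [Fintype s] (σ : Matrix (r × s) (r × s) ℂ)
    (ρR : Matrix r r ℂ) (ρS : Matrix s s ℂ) : Prop :=
  traceS σ = ρR ∧ traceR σ = ρS

/-- The map `E ⊗ id` on operators on `ℂ^n ⊗ ℂ^k`: it applies `E` to every `n × n` block. -/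
def ampliation {n : Type*} (k : ℕ) (E : Matrix n n ℂ →ₗ[ℂ] Matrix n n ℂ)
    (X : Matrix (n × Fin k) (n × Fin k) ℂ) : Matrix (n × Fin k) (n × Fin k) ℂ :=
  Matrix.of fun p q => E (Matrix.of fun i j => X (i, p.2) (j, q.2)) p.1 q.1

/-- A quantum channel (quantum operation): a completely positive and trace-preserving linear
map on the operators on `ℂ^n`. -/
def IsChannel {n : Type*} [Fintype n] (E : Matrix n n ℂ →ₗ[ℂ] Matrix n n ℂ) : Prop :=
  (∀ (k : ℕ) (X : Matrix (n × Fin k) (n × Fin k) ℂ),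
    X.PosSemidef → (ampliation k E X).PosSemidef) ∧
  ∀ X : Matrix n n ℂ, (E X).trace = X.trace

/-- The map `X ↦ U X U†`. -/
def conjBy {n : Type*} [Fintype n] (U X : Matrix n n ℂ) : Matrix n n ℂ :=
  U * X * Uᴴ

/-- A continuous, possibly projective, unitary representation of `G` on `ℂ^n`: the product is
preserved up to a phase, and continuity is that of the induced map into the projective unitary
group, that is, of `g ↦ U_g X U_g†` for every operator `X`. Every ordinary continuous unitary
representation is of this kind. -/
structure ProjUnitaryRep (G : Type*) [Group G] [TopologicalSpace G]
    (n : Type*) [Fintype n] [DecidableEq n] where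
  /-- The unitary `U_g`. -/
  U : G → Matrix n n ℂ
  unitary : ∀ g, U g ∈ Matrix.unitaryGroup n ℂ
  mul_phase : ∀ g h, ∃ c : ℂ, ‖c‖ = 1 ∧ U (g * h) = c • (U g * U h)
  continuous_conj : ∀ X : Matrix n n ℂ, Continuous fun g => conjBy (U g) X

/-- `ρ` is symmetric for the family of unitaries `U`: `U_g ρ U_g† = ρ` for every `g`.
It is asymmetric if this fails for at least one `g`. -/
def IsSymmetric {G n : Type*} [Fintype n] (U : G → Matrix n n ℂ) (ρ : Matrix n n ℂ) : Prop :=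
  ∀ g, conjBy (U g) ρ = ρ

/-- `E` is covariant for the family of unitaries `U`: it commutes with `X ↦ U_g X U_g†`
for every `g`. -/
def IsCovariant {G n : Type*} [Fintype n] (U : G → Matrix n n ℂ)
    (E : Matrix n n ℂ →ₗ[ℂ] Matrix n n ℂ) : Prop :=
  ∀ g X, E (conjBy (U g) X) = conjBy (U g) (E X)

/-- The time evolution `exp(-i t H)` generated by the Hamiltonian `H`. -/
noncomputable def timeEvolution {n : Type*} [Fintype n] [DecidableEq n] (H : Matrix n n ℂ)
    (t : ℝ) : Matrix n n ℂ :=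
  NormedSpace.exp ((-(Complex.I * (t : ℂ))) • H)

/-- The finite-dimensional system `R`, on which `G` acts by `UR`, can weakly broadcast
`G`-asymmetry: there are a finite-dimensional system `S` with a representation of `G`, a
`G`-symmetric state `ρS` of `S`, and sequences of `G`-covariant channels on `RS` and of states
of `R`, such that the `n`-th channel takes the `n`-th state of `R` together with a fresh `ρS` to
a joint state whose marginals are the `(n+1)`-st state of `R` and one and the same `G`-asymmetric
`ρS'`. -/
def WeaklyBroadcastsAsymmetry {G : Type*} [Group G] [TopologicalSpace G]
    {r : Type*} [Fintype r] [DecidableEq r] (UR : ProjUnitaryRep G r) : Prop :=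
  ∃ (d : ℕ) (US : ProjUnitaryRep G (Fin d)) (ρS ρS' : Matrix (Fin d) (Fin d) ℂ)
    (E : ℕ → Matrix (r × Fin d) (r × Fin d) ℂ →ₗ[ℂ] Matrix (r × Fin d) (r × Fin d) ℂ)
    (ρR : ℕ → Matrix r r ℂ),
    IsState ρS ∧ IsSymmetric US.U ρS ∧
    (∀ n, IsChannel (E n) ∧ IsCovariant (fun g => UR.U g ⊗ₖ US.U g) (E n)) ∧
    (∀ n, IsState (ρR n)) ∧
    (∀ n, IsJoint (E n (ρR n ⊗ₖ ρS)) (ρR (n + 1)) ρS') ∧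
    ¬ IsSymmetric US.U ρS'

/-- The finite-dimensional system `R` with Hamiltonian `HR` can weakly broadcast coherence: the
case of time translations. Here `ρS` commutes with the Hamiltonian `HS` of `S`, the marginal
`ρS'` does not, and the channels are covariant for the joint evolution
`exp(-itHR) ⊗ exp(-itHS)`, that is, for the total Hamiltonian `HR ⊗ 1 + 1 ⊗ HS`. -/
def WeaklyBroadcastsCoherence {r : Type*} [Fintype r] [DecidableEq r]
    (HR : Matrix r r ℂ) : Prop :=
  ∃ (d : ℕ) (HS : Matrix (Fin d) (Fin d) ℂ) (ρS ρS' : Matrix (Fin d) (Fin d) ℂ)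
    (E : ℕ → Matrix (r × Fin d) (r × Fin d) ℂ →ₗ[ℂ] Matrix (r × Fin d) (r × Fin d) ℂ)
    (ρR : ℕ → Matrix r r ℂ),
    HS.IsHermitian ∧ IsState ρS ∧ Commute ρS HS ∧
    (∀ n, IsChannel (E n) ∧
      IsCovariant (fun t : ℝ => timeEvolution HR t ⊗ₖ timeEvolution HS t) (E n)) ∧
    (∀ n, IsState (ρR n)) ∧
    (∀ n, IsJoint (E n (ρR n ⊗ₖ ρS)) (ρR (n + 1)) ρS') ∧
    ¬ Commute ρS' HS

end QBroadcast

namespace QBroadcast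

/-! Two steps: compactness replaces the infinite sequence by one exactly repeatable round, and an
algebraic rigidity argument excludes asymmetric output from such a round.

Compactness. With `ρS` absorbed, each channel becomes a Kraus family on `R` whose extra label is a
basis index of `S`: `krausMap` gives the new state of `R`, `complementMap` the output on `S`. For `n
< m`, one round followed by a covariant channel carrying `ρR (n + 1)` to `ρR m` takes `ρR n` to `ρR
m` and still emits `ρS'`, because later operations on `R` cannot change the marginal of `S`. All
these families lie in one compact set. Along a convergent subsequence of states, the limit family
fixes a state `τ` and emits `ρS'` (`exists_fixed_of_transitions`).

Rigidity (`isSymmetric_complementMap_of_fixed`). On the support of a symmetric invariant operator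
dominating the fixed state, every Hermitian fixed point of the dual map commutes with the Kraus
operators. An observable `A` on `S` pulls back to a combination `B` of products of adjoint Kraus
operators with Kraus operators, so `B`, and also its time average `X`, commutes with all these fixed
points. The conjugates of `X` under the group are fixed points too, hence commute pairwise; a
continuous family of commuting unitary conjugates over a connected space is constant, so `X` is
symmetric. The expectation of `A` in the output is then the same for every translate of the fixed
state. Taking for `A` the difference of a translated output and the output itself gives `tr A² = 0`.
-/

/-- **Markov–Kakutani** for one linear map in finite dimension. -/
theorem exists_fixed_of_mapsTo {E : Type*} [NormedAddCommGroup E] [NormedSpace ℝ E]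
    [FiniteDimensional ℝ E] (T : E →ₗ[ℝ] E) {C : Set E} (hC : IsCompact C) (hconv : Convex ℝ C)
    (hne : C.Nonempty) (hT : Set.MapsTo T C C) : ∃ y ∈ C, T y = y := by
  obtain ⟨x, hx⟩ := hne
  have horb : ∀ i : ℕ, (T ^ i) x ∈ C := fun i => by
    induction i with
    | zero => simpa
    | succ i ih => rw [pow_succ']; exact hT ih
  let a : ℕ → E := fun n => ∑ i ∈ Finset.range (n + 1), ((n : ℝ) + 1)⁻¹ • (T ^ i) x
  have ha : ∀ n, a n ∈ C := fun n => by
    refine hconv.sum_mem (fun i _ => by positivity) ?_ fun i _ => horb i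
    simp only [Finset.sum_const, Finset.card_range, nsmul_eq_mul]
    push_cast
    field_simp
  obtain ⟨y, hy, φ, hφ, hlim⟩ := hC.tendsto_subseq ha
  refine ⟨y, hy, ?_⟩
  have hdiff : ∀ n, T (a n) - a n = ((n : ℝ) + 1)⁻¹ • ((T ^ (n + 1)) x - x) := fun n => by
    have h := Finset.sum_range_sub (fun i => (T ^ i) x) (n + 1)
    simp only [pow_zero, Module.End.one_apply] at h
    rw [← h, Finset.smul_sum, map_sum, ← Finset.sum_sub_distrib]
    refine Finset.sum_congr rfl fun i _ => ?_
    rw [map_smul, smul_sub, pow_succ', Module.End.mul_apply]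
  obtain ⟨R, hR⟩ := hC.isBounded.exists_norm_le
  have hzero : Filter.Tendsto (fun n => T (a n) - a n) Filter.atTop (nhds 0) := by
    have h1 : Filter.Tendsto (fun n : ℕ => ((n : ℝ) + 1)⁻¹ * (R + R)) Filter.atTop (nhds 0) := by
      simpa [one_div] using (tendsto_one_div_add_atTop_nhds_zero_nat (𝕜 := ℝ)).mul_const (R + R)
    refine squeeze_zero_norm (fun n => ?_) h1
    rw [hdiff, norm_smul, Real.norm_of_nonneg (by positivity)]
    gcongr
    exact (norm_sub_le _ _).trans (add_le_add (hR _ (horb _)) (hR _ hx))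
  have hTc : Continuous T := T.continuous_of_finiteDimensional
  have h2 : Filter.Tendsto (fun n => T (a (φ n)) - a (φ n)) Filter.atTop (nhds (T y - y)) :=
    ((hTc.tendsto y).comp hlim).sub hlim
  exact sub_eq_zero.mp (tendsto_nhds_unique h2 (hzero.comp hφ.tendsto_atTop))

/-! ### Positive semidefinite matrices and compactness of the state space -/

section Matrices
variable {n : Type*} [Fintype n]

theorem isClosed_posSemidef : IsClosed {M : Matrix n n ℂ | M.PosSemidef} := by
  have : {M : Matrix n n ℂ | M.PosSemidef} =
      {M | Mᴴ = M} ∩ ⋂ x : n → ℂ, {M | 0 ≤ star x ⬝ᵥ (M *ᵥ x)} := by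
    ext M
    simp [Matrix.posSemidef_iff_dotProduct_mulVec, Matrix.IsHermitian]
  rw [this]
  refine (isClosed_eq (by fun_prop) (by fun_prop)).inter (isClosed_iInter fun x => ?_)
  exact isClosed_le continuous_const (by fun_prop)

omit [Fintype n] in
theorem convex_posSemidef : Convex ℝ {M : Matrix n n ℂ | M.PosSemidef} := by
  intro A hA B hB a b ha hb _
  exact (hA.smul ha).add (hB.smul hb)

open scoped MatrixOrder Matrix.Norms.L2Operator in
theorem exists_eq_mul_conjTranspose {M : Matrix n n ℂ} (hM : M.PosSemidef) :
    ∃ C : Matrix n n ℂ, M = C * Cᴴ := by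
  classical
  exact CStarAlgebra.nonneg_iff_eq_mul_star_self.mp (Matrix.nonneg_iff_posSemidef.mpr hM)

/-- For `M = C * Cᴴ` an entry is an inner product of two rows of `C`, whose squared norms are
diagonal entries of `M`. This entrywise bound makes sets of bounded trace compact. -/
theorem norm_apply_le_trace {M : Matrix n n ℂ} (hM : M.PosSemidef) (i j : n) :
    ‖M i j‖ ≤ M.trace.re := by
  obtain ⟨C, rfl⟩ := exists_eq_mul_conjTranspose hM
  have hdiag : ∀ i, ((C * Cᴴ) i i).re = ∑ k, ‖C i k‖ ^ 2 := fun i => by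
    simp only [Matrix.mul_apply, Complex.re_sum, Matrix.conjTranspose_apply]
    refine Finset.sum_congr rfl fun k _ => ?_
    rw [RCLike.star_def, Complex.mul_conj, Complex.normSq_eq_norm_sq, Complex.ofReal_re]
  have htr : ∀ i, ∑ k, ‖C i k‖ ^ 2 ≤ (C * Cᴴ).trace.re := fun i => by
    rw [Matrix.trace, Complex.re_sum]
    simp only [Matrix.diag_apply, hdiag]
    exact Finset.single_le_sum (f := fun i => ∑ k, ‖C i k‖ ^ 2)
      (fun i _ => Finset.sum_nonneg fun k _ => by positivity) (Finset.mem_univ i)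
  have h1 : ‖(C * Cᴴ) i j‖ ≤ ∑ k, ‖C i k‖ * ‖C j k‖ := by
    rw [Matrix.mul_apply]
    refine (norm_sum_le _ _).trans (le_of_eq (Finset.sum_congr rfl fun k _ => ?_))
    rw [Matrix.conjTranspose_apply, norm_mul, norm_star]
  have h2 : ∑ k, ‖C i k‖ * ‖C j k‖ ≤ ∑ k, (‖C i k‖ ^ 2 + ‖C j k‖ ^ 2) / 2 :=
    Finset.sum_le_sum fun k _ => by nlinarith [sq_nonneg (‖C i k‖ - ‖C j k‖)]
  rw [← Finset.sum_div, Finset.sum_add_distrib] at h2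
  linarith [htr i, htr j]

omit [Fintype n] in
theorem isCompact_norm_apply_le {m : Type*} (c : ℝ) :
    IsCompact {M : Matrix m n ℂ | ∀ i j, ‖M i j‖ ≤ c} := by
  have : {M : Matrix m n ℂ | ∀ i j, ‖M i j‖ ≤ c} =
      Set.univ.pi fun _ : m => Set.univ.pi fun _ : n => Metric.closedBall (0 : ℂ) c := by
    ext M
    exact ⟨fun h i _ j _ => mem_closedBall_zero_iff.mpr (h i j),
      fun h i j => mem_closedBall_zero_iff.mp (h i trivial j trivial)⟩
  rw [this]
  exact isCompact_univ_pi fun _ => isCompact_univ_pi fun _ => isCompact_closedBall _ _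

theorem isCompact_posSemidef_trace_le (c : ℝ) :
    IsCompact {M : Matrix n n ℂ | M.PosSemidef ∧ M.trace.re ≤ c} := by
  refine (isCompact_norm_apply_le c).of_isClosed_subset ?_
    fun M hM i j => (norm_apply_le_trace hM.1 i j).trans hM.2
  exact isClosed_posSemidef.inter (isClosed_le
    (f := fun M : Matrix n n ℂ => M.trace.re) (by fun_prop) continuous_const)

theorem isCompact_isState : IsCompact {M : Matrix n n ℂ | IsState M} := by
  refine (isCompact_posSemidef_trace_le 1).of_isClosed_subset ?_ fun M hM => ⟨hM.1, ?_⟩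
  · exact isClosed_posSemidef.inter (isClosed_eq (by fun_prop) continuous_const)
  · rw [hM.2, Complex.one_re]

variable [DecidableEq n]

open scoped MatrixOrder Matrix.Norms.L2Operator in
theorem exists_posSemidef_smul_one_sub {M : Matrix n n ℂ} (hM : M.IsHermitian) :
    ∃ c : ℝ, 0 ≤ c ∧ (c • (1 : Matrix n n ℂ) - M).PosSemidef ∧
      (c • (1 : Matrix n n ℂ) + M).PosSemidef := by
  refine ⟨‖M‖, norm_nonneg _, ?_, ?_⟩
  · have := IsSelfAdjoint.le_algebraMap_norm_self (a := M) hM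
    rwa [Matrix.le_iff, Algebra.algebraMap_eq_smul_one] at this
  · have := IsSelfAdjoint.neg_algebraMap_norm_le_self (a := M) hM
    rwa [Matrix.le_iff, Algebra.algebraMap_eq_smul_one, sub_neg_eq_add, add_comm] at this

/-! ### Rigidity of commuting projections and commuting conjugates -/

theorem conjBy_eq_conjStarAlgAut {U : Matrix n n ℂ} (hU : U ∈ Matrix.unitaryGroup n ℂ)
    (X : Matrix n n ℂ) : conjBy U X = Unitary.conjStarAlgAut ℂ _ ⟨U, hU⟩ X := rfl

-- The difference `D` of two commuting idempotents satisfies `D³ = D`, so `‖D‖ ≤ ‖D‖³`, which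
-- excludes `0 < ‖D‖ < 1`.
open scoped Matrix.Norms.L2Operator in
theorem eq_of_commute_of_norm_sub_lt_one {P Q : Matrix n n ℂ} (hP : P * P = P) (hQ : Q * Q = Q)
    (h : Commute P Q) (hlt : ‖P - Q‖ < 1) : P = Q := by
  have hD : (P - Q) * (P - Q) * (P - Q) = P - Q := by
    have h1 : (P - Q) * (P - Q) = P + Q - 2 • (P * Q) := by
      rw [sub_mul, mul_sub, mul_sub, hP, hQ, ← h.eq, two_smul]; abel
    have h2 : P * Q * P = P * Q := by rw [mul_assoc, ← h.eq, ← mul_assoc, hP]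
    have h3 : P * Q * Q = P * Q := by rw [mul_assoc, hQ]
    rw [h1, sub_mul, add_mul, mul_sub, mul_sub, hP, hQ, smul_mul_assoc, mul_sub, h2, h3, ← h.eq]
    simp
  by_contra hne
  have hpos : 0 < ‖P - Q‖ := norm_pos_iff.mpr (sub_ne_zero.mpr hne)
  have h1 : ‖P - Q‖ ≤ ‖P - Q‖ * ‖P - Q‖ * ‖P - Q‖ := by
    calc ‖P - Q‖ = ‖(P - Q) * (P - Q) * (P - Q)‖ := by rw [hD]
      _ ≤ _ := (norm_mul_le _ _).trans (by gcongr; exact norm_mul_le _ _)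
  nlinarith [mul_pos hpos hpos]

open scoped Matrix.Norms.L2Operator in
theorem eq_of_continuous_of_commute_projections {G : Type*} [TopologicalSpace G]
    [PreconnectedSpace G] {P : G → Matrix n n ℂ} (hP : ∀ g, P g * P g = P g)
    (hcont : Continuous P) (hcomm : ∀ g h, Commute (P g) (P h)) (g h : G) : P g = P h := by
  have hloc : IsLocallyConstant P := by
    rw [IsLocallyConstant.iff_eventually_eq]
    intro x
    filter_upwards [hcont.continuousAt.eventually (Metric.ball_mem_nhds (P x) one_pos)] with y hy
    exact eq_of_commute_of_norm_sub_lt_one (hP y) (hP x) (hcomm y x) (by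
      rwa [← dist_eq_norm])
  exact hloc.apply_eq_of_preconnectedSpace g h

/-- A continuous family of pairwise commuting unitary conjugates of a Hermitian matrix
is constant. -/
theorem conjBy_eq_of_commute {G : Type*} [TopologicalSpace G] [PreconnectedSpace G]
    {U : G → Matrix n n ℂ} (hU : ∀ g, U g ∈ Matrix.unitaryGroup n ℂ)
    (hcont : ∀ X, Continuous fun g => conjBy (U g) X) {X : Matrix n n ℂ} (hX : X.IsHermitian)
    (hcomm : ∀ g h, Commute (conjBy (U g) X) (conjBy (U h) X)) (g h : G) :
    conjBy (U g) X = conjBy (U h) X := by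
  classical
  have hsa : IsSelfAdjoint X := hX
  have hfin := Matrix.finite_real_spectrum (A := X)
  -- Indicator of the point `l`: `cfc (p l) X` is the spectral projection at `l`. It is continuous
  -- on the spectrum because the spectrum is finite.
  let p : ℝ → ℝ → ℝ := fun l x => if x = l then 1 else 0
  have hpc : ∀ l, ContinuousOn (p l) (spectrum ℝ X) := fun l => hfin.continuousOn _
  have hconj : ∀ g l, conjBy (U g) (cfc (p l) X) = cfc (p l) (conjBy (U g) X) := fun g l => by
    rw [conjBy_eq_conjStarAlgAut (hU g), conjBy_eq_conjStarAlgAut (hU g)]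
    refine StarAlgHomClass.map_cfc (R := ℝ) (S := ℂ) (φ := Unitary.conjStarAlgAut ℂ _ ⟨U g, hU g⟩)
      (f := p l) (a := X) (hpc l) ?_ hsa (hsa.map _)
    exact (by fun_prop : Continuous fun X => U g * X * star (U g))
  have hproj : ∀ l, cfc (p l) X * cfc (p l) X = cfc (p l) X := fun l => by
    rw [← cfc_mul _ _ X (hpc l) (hpc l)]
    congr 1; ext x; simp [p]
  have key : ∀ l, conjBy (U g) (cfc (p l) X) = conjBy (U h) (cfc (p l) X) := fun l => by
    refine eq_of_continuous_of_commute_projections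
      (P := fun g => conjBy (U g) (cfc (p l) X)) (fun g => ?_) (hcont _) (fun g h => ?_) g h
    · simp only [conjBy_eq_conjStarAlgAut (hU g)]
      rw [← map_mul, hproj]
    · simp only [hconj]
      exact ((hcomm g h).cfc_real _).symm.cfc_real _ |>.symm
  have hsum : X = ∑ l ∈ hfin.toFinset, (l : ℂ) • cfc (p l) X := by
    conv_lhs => rw [← cfc_id' ℝ X]
    have h1 : ∀ l : ℝ, (l : ℂ) • cfc (p l) X = cfc (fun x => l * p l x) X := fun l => by
      rw [cfc_const_mul _ _ X (hpc l), Complex.coe_smul]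
    simp only [h1]
    rw [← cfc_sum _ _ _ fun l _ => hfin.continuousOn _]
    refine cfc_congr fun x hx => ?_
    simp only [Finset.sum_apply, p, mul_ite, mul_one, mul_zero]
    rw [Finset.sum_ite_eq, if_pos (hfin.mem_toFinset.mpr hx)]
  rw [hsum, conjBy_eq_conjStarAlgAut (hU g), conjBy_eq_conjStarAlgAut (hU h)]
  simp only [map_sum, map_smul]
  exact Finset.sum_congr rfl fun l _ => congrArg _ (key l)

end Matrices
-- Kraus maps, complementary outputs and their duals
/-- The completely positive map with Kraus operators `L j`. -/
def krausMap {κ m n : Type*} [Fintype κ] [Fintype n] (L : κ → Matrix m n ℂ) :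
    Matrix n n ℂ →ₗ[ℂ] Matrix m m ℂ where
  toFun X := ∑ j, L j * X * (L j)ᴴ
  map_add' X Y := by simp [Matrix.mul_add, Matrix.add_mul, Finset.sum_add_distrib]
  map_smul' c X := by simp [Finset.smul_sum]

/-- The complementary output, in the second factor, of a Kraus family indexed by a product. -/
def complementMap {κ s m n : Type*} [Fintype κ] [Fintype m] [Fintype n]
    (L : κ × s → Matrix m n ℂ) (X : Matrix n n ℂ) : Matrix s s ℂ :=
  Matrix.of fun a b => ∑ j, (L (j, a) * X * (L (j, b))ᴴ).trace

section
variable {κ s m n : Type*} [Fintype κ] [Fintype s] [Fintype m] [Fintype n]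

omit [Fintype m] in
theorem krausMap_apply (L : κ → Matrix m n ℂ) (X : Matrix n n ℂ) :
    krausMap L X = ∑ j, L j * X * (L j)ᴴ := rfl

theorem krausMap_posSemidef (L : κ → Matrix m n ℂ) {X : Matrix n n ℂ} (hX : X.PosSemidef) :
    (krausMap L X).PosSemidef :=
  Matrix.posSemidef_sum _ fun j _ => hX.mul_mul_conjTranspose_same (L j)

theorem trace_krausMap_mul (L : κ → Matrix m n ℂ) (X : Matrix n n ℂ) (Y : Matrix m m ℂ) :
    (krausMap L X * Y).trace = (X * krausMap (fun j => (L j)ᴴ) Y).trace := by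
  simp only [krausMap_apply, Finset.sum_mul, Finset.mul_sum, Matrix.trace_sum,
    Matrix.conjTranspose_conjTranspose]
  refine Finset.sum_congr rfl fun j _ => ?_
  rw [Matrix.mul_assoc, Matrix.mul_assoc, Matrix.trace_mul_comm]
  simp only [Matrix.mul_assoc]

theorem trace_krausMap [DecidableEq n] (L : κ → Matrix m n ℂ) (X : Matrix n n ℂ) :
    (krausMap L X).trace = (X * ∑ j, (L j)ᴴ * L j).trace := by
  classical
  have := trace_krausMap_mul L X 1
  simpa [krausMap_apply] using this

omit [Fintype s] in
theorem complementMap_conjTranspose (L : κ × s → Matrix m n ℂ) (X : Matrix n n ℂ) :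
    (complementMap L X)ᴴ = complementMap L Xᴴ := by
  ext a b
  simp only [complementMap, Matrix.conjTranspose_apply, Matrix.of_apply, star_sum]
  refine Finset.sum_congr rfl fun j _ => ?_
  rw [← Matrix.trace_conjTranspose]
  simp [Matrix.mul_assoc]

/-- The dual of `complementMap`. -/
def complementDual (L : κ × s → Matrix m n ℂ) (A : Matrix s s ℂ) : Matrix n n ℂ :=
  ∑ j, ∑ a, ∑ b, A b a • ((L (j, b))ᴴ * L (j, a))

theorem trace_mul_complementMap (L : κ × s → Matrix m n ℂ) (A : Matrix s s ℂ)
    (X : Matrix n n ℂ) :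
    (A * complementMap L X).trace = (complementDual L A * X).trace := by
  have h1 : (A * complementMap L X).trace =
      ∑ b, ∑ a, A b a * ∑ j, (L (j, a) * X * (L (j, b))ᴴ).trace := rfl
  have h2 : ∀ j a b, (L (j, a) * X * (L (j, b))ᴴ).trace = ((L (j, b))ᴴ * L (j, a) * X).trace :=
    fun j a b => by rw [Matrix.trace_mul_comm, Matrix.mul_assoc]
  simp only [h1, h2, complementDual, Matrix.sum_mul, Matrix.trace_sum, Matrix.smul_mul,
    Matrix.trace_smul, Finset.mul_sum, smul_eq_mul]
  rw [Finset.sum_comm]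
  conv_rhs => rw [Finset.sum_comm]
  refine Finset.sum_congr rfl fun a _ => Finset.sum_comm

omit [Fintype n] in
theorem complementDual_conjTranspose (L : κ × s → Matrix m n ℂ) {A : Matrix s s ℂ}
    (hA : A.IsHermitian) : (complementDual L A).IsHermitian := by
  unfold Matrix.IsHermitian complementDual
  simp only [Matrix.conjTranspose_sum, Matrix.conjTranspose_smul, Matrix.conjTranspose_mul,
    Matrix.conjTranspose_conjTranspose]
  refine Finset.sum_congr rfl fun j _ => ?_
  rw [Finset.sum_comm]
  refine Finset.sum_congr rfl fun a _ => Finset.sum_congr rfl fun b _ => ?_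
  rw [hA.apply]

/-- With `τ = C * Cᴴ` the trace is the squared Hilbert–Schmidt norm of `Z * C`. -/
theorem mul_eq_zero_of_trace_eq_zero {τ Z : Matrix n n ℂ} (hτ : τ.PosSemidef)
    (h : (Z * τ * Zᴴ).trace = 0) : Z * τ = 0 := by
  obtain ⟨C, rfl⟩ := exists_eq_mul_conjTranspose hτ
  have : (Z * C * (Z * C)ᴴ).trace = 0 := by
    rw [← h, Matrix.conjTranspose_mul]; simp only [Matrix.mul_assoc]
  rw [Matrix.trace_mul_conjTranspose_self_eq_zero_iff] at this
  rw [← Matrix.mul_assoc, this, Matrix.zero_mul]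

theorem mul_eq_zero_of_sum_trace_eq_zero {τ : Matrix n n ℂ} (hτ : τ.PosSemidef)
    {Z : κ → Matrix n n ℂ} (h : ∑ j, (Z j * τ * (Z j)ᴴ).trace = 0) (j : κ) : Z j * τ = 0 := by
  refine mul_eq_zero_of_trace_eq_zero hτ ?_
  exact (Finset.sum_eq_zero_iff_of_nonneg
    fun j _ => (hτ.mul_mul_conjTranspose_same (Z j)).trace_nonneg).mp h j (Finset.mem_univ j)

open scoped Matrix.Norms.L2Operator in
/-- The support projection of a positive semidefinite matrix. -/
theorem exists_support_projection [DecidableEq n] {τ : Matrix n n ℂ} (hτ : τ.PosSemidef) :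
    ∃ P : Matrix n n ℂ, Pᴴ = P ∧ P * P = P ∧ P * τ = τ ∧ (∀ Z, Z * τ = 0 → Z * P = 0) ∧
      ∀ U, Commute U τ → Commute U P := by
  have hsa : IsSelfAdjoint τ := hτ.isHermitian
  have hfin := Matrix.finite_real_spectrum (A := τ)
  have hid : cfc (fun x : ℝ => x) τ = τ := cfc_id' ℝ τ
  have hmul : ∀ f : ℝ → ℝ, τ * cfc f τ = cfc (fun x => x * f x) τ := fun f => by
    conv_lhs => rw [← hid]
    rw [cfc_mul _ _ _ (hfin.continuousOn _) (hfin.continuousOn _), hid]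
  -- Since `0⁻¹ = 0`, this function is the indicator of the nonzero reals; the factorization `P = τ
  -- * cfc (·⁻¹) τ` shows that whatever kills `τ` on the right of it kills `P`.
  refine ⟨cfc (fun x : ℝ => x * x⁻¹) τ, ?_, ?_, ?_, fun Z hZ => ?_, fun U hU => ?_⟩
  · exact cfc_predicate (fun x : ℝ => x * x⁻¹) τ
  · rw [← cfc_mul _ _ _ (hfin.continuousOn _) (hfin.continuousOn _)]
    congr 1; ext x; by_cases hx : x = 0 <;> simp [hx]
  · rw [((Commute.refl τ).cfc_real _).eq, hmul]
    conv_rhs => rw [← hid]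
    congr 1; ext x; by_cases hx : x = 0 <;> simp [hx]
  · rw [← hmul, ← Matrix.mul_assoc, hZ, Matrix.zero_mul]
  · exact (hU.symm.cfc_real _).symm

/-- Fixed points of the dual of a quantum operation with a faithful invariant state commute
with the Kraus operators; here on the corner cut out by the projection `P`. -/
theorem commute_of_dual_fixed {L : κ → Matrix n n ℂ} {P τ Y : Matrix n n ℂ}
    (hP : Pᴴ = P) (hLP : ∀ j, L j * P = L j) (hsum : ∑ j, (L j)ᴴ * L j = P)
    (hτ : τ.PosSemidef) (hfix : krausMap L τ = τ) (hfaith : ∀ Z, Z * τ = 0 → Z * P = 0)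
    (hY : Yᴴ = Y) (hPY : P * Y = Y) (hYfix : krausMap (fun j => (L j)ᴴ) Y = Y) (j : κ) :
    Commute Y (L j) := by
  have hYP : Y * P = Y := by
    have := congrArg Matrix.conjTranspose hPY
    rwa [Matrix.conjTranspose_mul, hP, hY] at this
  -- The sum of squared commutators equals `T (Y²) - Y²` for the dual map `T`. Its expectation in
  -- the invariant `τ` is zero, so each commutator kills `τ`, hence `P`.
  have hZ : ∑ j, (Y * L j - L j * Y)ᴴ * (Y * L j - L j * Y) =
      krausMap (fun j => (L j)ᴴ) (Y * Y) - Y * Y := by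
    have h1 : ∀ j, (Y * L j - L j * Y)ᴴ * (Y * L j - L j * Y) =
        (L j)ᴴ * (Y * Y) * L j - ((L j)ᴴ * Y * L j) * Y - Y * ((L j)ᴴ * Y * L j)
          + Y * ((L j)ᴴ * L j) * Y := fun j => by
      rw [Matrix.conjTranspose_sub, Matrix.conjTranspose_mul, Matrix.conjTranspose_mul, hY]
      noncomm_ring
    simp only [h1, Finset.sum_add_distrib, Finset.sum_sub_distrib, ← Finset.sum_mul,
      ← Finset.mul_sum]
    simp only [krausMap_apply, Matrix.conjTranspose_conjTranspose] at hYfix ⊢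
    rw [hYfix, hsum, hYP]
    abel
  have htr : ∑ j, ((Y * L j - L j * Y) * τ * (Y * L j - L j * Y)ᴴ).trace = 0 := by
    have h1 : ∀ j, ((Y * L j - L j * Y) * τ * (Y * L j - L j * Y)ᴴ).trace =
        (τ * ((Y * L j - L j * Y)ᴴ * (Y * L j - L j * Y))).trace := fun j => by
      rw [Matrix.mul_assoc, Matrix.trace_mul_comm, Matrix.mul_assoc]
    simp only [h1]
    rw [← Matrix.trace_sum, ← Finset.mul_sum, hZ, mul_sub, Matrix.trace_sub,
      ← trace_krausMap_mul, hfix, sub_self]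
  have h0 := hfaith _ (mul_eq_zero_of_sum_trace_eq_zero hτ htr j)
  rw [sub_mul, mul_assoc, hLP, mul_assoc, hYP] at h0
  exact sub_eq_zero.mp h0

end
-- Averaged fixed points with prescribed properties
section
variable {κ s n : Type*} [Fintype κ] [Fintype s] [Fintype n] [DecidableEq n]

/-- A fixed point of the dual of a quantum operation, obtained by averaging a Hermitian element
`B` over the dynamics; it inherits commutation relations and expectation values from `B`. -/
theorem exists_dual_fixed {L : κ → Matrix n n ℂ} {P B : Matrix n n ℂ}
    (hP : Pᴴ = P) (hP2 : P * P = P) (hLP : ∀ j, L j * P = L j) (hPL : ∀ j, P * L j = L j)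
    (hsum : ∑ j, (L j)ᴴ * L j = P) (hB : B.IsHermitian) (hPB : P * B * P = B)
    (hcomm : ∀ Y, (∀ j, Commute Y (L j)) → (∀ j, Commute Y (L j)ᴴ) → Commute B Y) :
    ∃ X : Matrix n n ℂ, X.IsHermitian ∧ P * X * P = X ∧ krausMap (fun j => (L j)ᴴ) X = X ∧
      (∀ Y, (∀ j, Commute Y (L j)) → (∀ j, Commute Y (L j)ᴴ) → Commute X Y) ∧
      ∀ σ, krausMap L σ = σ → (X * σ).trace = (B * σ).trace := by
  obtain ⟨c, hc0, hc1, hc2⟩ := exists_posSemidef_smul_one_sub hB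
  set T := krausMap (fun j => (L j)ᴴ) with hT
  have hTP : T P = P := by
    rw [hT, krausMap_apply, ← hsum]
    refine Finset.sum_congr rfl fun j _ => ?_
    rw [hsum, Matrix.mul_assoc, Matrix.conjTranspose_conjTranspose, hPL]
  have hLP' : ∀ j, P * (L j)ᴴ = (L j)ᴴ := fun j => by
    rw [← hP, ← Matrix.conjTranspose_mul, hLP]
  have hTcorner : ∀ X, P * T X * P = T X := fun X => by
    simp only [hT, krausMap_apply, Finset.mul_sum, Finset.sum_mul,
      Matrix.conjTranspose_conjTranspose]
    refine Finset.sum_congr rfl fun j _ => ?_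
    rw [mul_assoc, mul_assoc, mul_assoc, hLP, ← mul_assoc, hLP', mul_assoc]
  -- Every property wanted of `X` is a closed convex condition that holds for `B` and is preserved
  -- by the dual map, so Markov–Kakutani yields a fixed point with all of them. The order interval
  -- is bounded by `c • P`, not `c • 1`, because `P` is what the dual map fixes; it supplies
  -- compactness.
  let C1 : Set (Matrix n n ℂ) := {X | (c • P - X).PosSemidef ∧ (c • P + X).PosSemidef}
  let C2 : Set (Matrix n n ℂ) := {X | P * X * P = X}
  let C3 : Set (Matrix n n ℂ) :=
    {X | ∀ Y, (∀ j, Commute Y (L j)) → (∀ j, Commute Y (L j)ᴴ) → X * Y = Y * X}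
  let C4 : Set (Matrix n n ℂ) :=
    {X | ∀ σ, krausMap L σ = σ → (X * σ).trace = (B * σ).trace}
  have hclosed1 : IsClosed C1 :=
    (isClosed_posSemidef.preimage (by fun_prop : Continuous fun X => c • P - X)).inter
      (isClosed_posSemidef.preimage (by fun_prop : Continuous fun X => c • P + X))
  have hclosed2 : IsClosed C2 := isClosed_eq (by fun_prop) (by fun_prop)
  have hclosed3 : IsClosed C3 := by
    simp only [C3, Set.ofPred_forall]
    exact isClosed_iInter fun Y => isClosed_iInter fun _ => isClosed_iInter fun _ =>
      isClosed_eq (by fun_prop) (by fun_prop)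
  have hclosed4 : IsClosed C4 := by
    simp only [C4, Set.ofPred_forall]
    exact isClosed_iInter fun Y => isClosed_iInter fun _ =>
      isClosed_eq (by fun_prop) (by fun_prop)
  have hcompact1 : IsCompact C1 := by
    refine ((isCompact_posSemidef_trace_le (n := n) (2 * (c * P.trace.re))).image
      (f := fun M => c • P - M) (by fun_prop)).of_isClosed_subset hclosed1 fun X hX =>
        ⟨c • P - X, ⟨hX.1, ?_⟩, by simp⟩
    have := (Complex.le_def.mp hX.2.trace_nonneg).1
    simp only [Matrix.trace_add, Matrix.trace_sub, Matrix.trace_smul, Complex.add_re,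
      Complex.sub_re, Complex.zero_re, Complex.smul_re, smul_eq_mul] at this ⊢
    linarith
  have hcompact : IsCompact (C1 ∩ (C2 ∩ (C3 ∩ C4))) :=
    hcompact1.inter_right (hclosed2.inter (hclosed3.inter hclosed4))
  have hconvex : Convex ℝ (C1 ∩ (C2 ∩ (C3 ∩ C4))) := by
    rintro X ⟨⟨hX1, hX1'⟩, hX2, hX3, hX4⟩ Y ⟨⟨hY1, hY1'⟩, hY2, hY3, hY4⟩ a b ha hb hab
    have hcP : c • P = a • c • P + b • c • P := by rw [← add_smul, hab, one_smul]
    refine ⟨⟨?_, ?_⟩, ?_, fun Z h h' => ?_, fun σ hσ => ?_⟩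
    · show (c • P - (a • X + b • Y)).PosSemidef
      rw [hcP, add_sub_add_comm, ← smul_sub, ← smul_sub]
      exact (hX1.smul ha).add (hY1.smul hb)
    · show (c • P + (a • X + b • Y)).PosSemidef
      rw [hcP, add_add_add_comm, ← smul_add, ← smul_add]
      exact (hX1'.smul ha).add (hY1'.smul hb)
    · show P * (a • X + b • Y) * P = a • X + b • Y
      rw [mul_add, add_mul, mul_smul_comm, mul_smul_comm, smul_mul_assoc, smul_mul_assoc, hX2, hY2]
    · rw [add_mul, mul_add, smul_mul_assoc, smul_mul_assoc, mul_smul_comm, mul_smul_comm,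
        hX3 Z h h', hY3 Z h h']
    · rw [add_mul, smul_mul_assoc, smul_mul_assoc, Matrix.trace_add, Matrix.trace_smul,
        Matrix.trace_smul, hX4 σ hσ, hY4 σ hσ, ← add_smul, hab, one_smul]
  have hmaps : Set.MapsTo T (C1 ∩ (C2 ∩ (C3 ∩ C4))) (C1 ∩ (C2 ∩ (C3 ∩ C4))) := by
    rintro X ⟨⟨hX1, hX1'⟩, hX2, hX3, hX4⟩
    have hcP : c • P = T (c • P) := by rw [LinearMap.map_smul_of_tower, hTP]
    refine ⟨⟨?_, ?_⟩, hTcorner X, fun Z h h' => ?_, fun σ hσ => ?_⟩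
    · show (c • P - T X).PosSemidef
      rw [hcP, ← map_sub]
      exact krausMap_posSemidef _ hX1
    · show (c • P + T X).PosSemidef
      rw [hcP, ← map_add]
      exact krausMap_posSemidef _ hX1'
    · simp only [hT, krausMap_apply, Finset.mul_sum, Finset.sum_mul,
        Matrix.conjTranspose_conjTranspose]
      -- `Z` passes through `(L j)ᴴ`, `X` and `L j` in turn.
      refine Finset.sum_congr rfl fun j _ => ?_
      rw [mul_assoc, ← (h j).eq, ← mul_assoc, mul_assoc _ X, hX3 Z h h', ← mul_assoc, ← mul_assoc,
        ← mul_assoc, (h' j).eq]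
    · rw [Matrix.trace_mul_comm, hT, ← trace_krausMap_mul, hσ, Matrix.trace_mul_comm, hX4 σ hσ]
  have hB' : B ∈ C1 ∩ (C2 ∩ (C3 ∩ C4)) := by
    refine ⟨⟨?_, ?_⟩, hPB, fun Y h h' => hcomm Y h h', fun σ _ => rfl⟩
    · have := hc1.mul_mul_conjTranspose_same P
      rwa [hP, mul_sub, sub_mul, hPB, mul_smul_comm, mul_one, smul_mul_assoc, hP2] at this
    · have := hc2.mul_mul_conjTranspose_same P
      rwa [hP, mul_add, add_mul, hPB, mul_smul_comm, mul_one, smul_mul_assoc, hP2] at this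
  have := open scoped Matrix.Norms.L2Operator in
    exists_fixed_of_mapsTo (T.restrictScalars ℝ) hcompact hconvex ⟨B, hB'⟩ hmaps
  obtain ⟨X, ⟨⟨hX1, hX1'⟩, hX2, hX3, hX4⟩, hXfix⟩ := this
  refine ⟨X, ?_, hX2, hXfix, fun Y h h' => hX3 Y h h', hX4⟩
  have := hX1.isHermitian
  unfold Matrix.IsHermitian at this ⊢
  rw [Matrix.conjTranspose_sub, Matrix.conjTranspose_smul, hP, star_trivial] at this
  exact sub_right_injective this

/-- There is an invariant positive semidefinite matrix that dominates a given invariant state and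
is symmetric whenever the dynamics is covariant. -/
theorem exists_dominating_invariant {G : Type*} {U : G → Matrix n n ℂ}
    (hU : ∀ g, U g ∈ Matrix.unitaryGroup n ℂ) {L : κ → Matrix n n ℂ}
    (hL : ∑ j, (L j)ᴴ * L j = 1) (hcov : IsCovariant U (krausMap L))
    {ρ : Matrix n n ℂ} (hρ : ρ.PosSemidef) (hρfix : krausMap L ρ = ρ) :
    ∃ (τ : Matrix n n ℂ) (c : ℝ), τ.PosSemidef ∧ krausMap L τ = τ ∧ (c • τ - ρ).PosSemidef ∧
      ∀ g, conjBy (U g) τ = τ := by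
  obtain ⟨c, hc0, hc1, -⟩ := exists_posSemidef_smul_one_sub hρ.isHermitian
  -- The averaging starts from the identity, which is symmetric and satisfies `c • 1 ≥ ρ`. The
  -- domination survives each step because `ρ` is itself fixed, and the trace bound gives
  -- compactness.
  let C : Set (Matrix n n ℂ) := {M | M.PosSemidef ∧ M.trace.re ≤ (1 : Matrix n n ℂ).trace.re} ∩
    ({M | (c • M - ρ).PosSemidef} ∩ {M | ∀ g, conjBy (U g) M = M})
  have hcompact : IsCompact C := by
    refine (isCompact_posSemidef_trace_le _).inter_right (IsClosed.inter ?_ ?_)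
    · exact isClosed_posSemidef.preimage (by fun_prop : Continuous fun M => c • M - ρ)
    · simp only [Set.ofPred_forall, conjBy]
      exact isClosed_iInter fun g => isClosed_eq (by fun_prop) (by fun_prop)
  have hconvex : Convex ℝ C := by
    rintro X ⟨⟨hX1, hX2⟩, hX3, hX4⟩ Y ⟨⟨hY1, hY2⟩, hY3, hY4⟩ a b ha hb hab
    refine ⟨⟨convex_posSemidef hX1 hY1 ha hb hab, ?_⟩, ?_, fun g => ?_⟩
    · rw [Matrix.trace_add, Matrix.trace_smul, Matrix.trace_smul, Complex.add_re, Complex.smul_re,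
        Complex.smul_re, smul_eq_mul, smul_eq_mul]
      calc _ ≤ a * (1 : Matrix n n ℂ).trace.re + b * (1 : Matrix n n ℂ).trace.re := by gcongr
        _ = _ := by rw [← add_mul, hab, one_mul]
    · have : c • (a • X + b • Y) - ρ = a • (c • X - ρ) + b • (c • Y - ρ) := by
        have hρ' : ρ = a • ρ + b • ρ := by rw [← add_smul, hab, one_smul]
        conv_lhs => rw [hρ']
        module
      show (c • (a • X + b • Y) - ρ).PosSemidef
      rw [this]
      exact (hX3.smul ha).add (hY3.smul hb)
    · have h1 := hX4 g
      have h2 := hY4 g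
      simp only [conjBy] at h1 h2 ⊢
      rw [mul_add, add_mul, mul_smul_comm, mul_smul_comm, smul_mul_assoc, smul_mul_assoc, h1, h2]
  have hone : (1 : Matrix n n ℂ) ∈ C := by
    refine ⟨⟨Matrix.PosSemidef.one, le_rfl⟩, hc1, fun g => ?_⟩
    rw [conjBy, mul_one]
    exact Matrix.mem_unitaryGroup_iff.mp (hU g)
  have hmaps : Set.MapsTo (krausMap L) C C := by
    rintro X ⟨⟨hX1, hX2⟩, hX3, hX4⟩
    refine ⟨⟨krausMap_posSemidef _ hX1, ?_⟩, ?_, fun g => ?_⟩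
    · rwa [trace_krausMap, hL, mul_one]
    · show (c • krausMap L X - ρ).PosSemidef
      rw [← hρfix, ← LinearMap.map_smul_of_tower, ← map_sub]
      exact krausMap_posSemidef _ hX3
    · rw [← hcov, hX4 g]
  have := open scoped Matrix.Norms.L2Operator in
    exists_fixed_of_mapsTo ((krausMap L).restrictScalars ℝ) hcompact hconvex ⟨1, hone⟩ hmaps
  obtain ⟨τ, ⟨⟨h1, -⟩, h2, h3⟩, h4⟩ := this
  exact ⟨τ, c, h1, h4, h2, h3⟩
end
-- A covariant operation with a fixed state has symmetric output
section
variable {κ s n : Type*} [Fintype κ] [Fintype s] [Fintype n] [DecidableEq n]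

theorem conjBy_conjTranspose_conjBy {U : Matrix n n ℂ} (hU : U ∈ Matrix.unitaryGroup n ℂ)
    (X : Matrix n n ℂ) : conjBy Uᴴ (conjBy U X) = X := by
  have h : Uᴴ * U = 1 := Matrix.mem_unitaryGroup_iff'.mp hU
  calc conjBy Uᴴ (conjBy U X) = (Uᴴ * U) * X * (Uᴴ * U) := by
        simp only [conjBy, Matrix.conjTranspose_conjTranspose, Matrix.mul_assoc]
    _ = X := by rw [h, one_mul, mul_one]

theorem conjBy_conjBy_conjTranspose {U : Matrix n n ℂ} (hU : U ∈ Matrix.unitaryGroup n ℂ)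
    (X : Matrix n n ℂ) : conjBy U (conjBy Uᴴ X) = X := by
  have h : U * Uᴴ = 1 := Matrix.mem_unitaryGroup_iff.mp hU
  calc conjBy U (conjBy Uᴴ X) = (U * Uᴴ) * X * (U * Uᴴ) := by
        simp only [conjBy, Matrix.conjTranspose_conjTranspose, Matrix.mul_assoc]
    _ = X := by rw [h, one_mul, mul_one]

omit [DecidableEq n] in
theorem trace_mul_conjBy (U X Y : Matrix n n ℂ) :
    (X * conjBy U Y).trace = (conjBy Uᴴ X * Y).trace := by
  simp only [conjBy, Matrix.conjTranspose_conjTranspose]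
  rw [← Matrix.mul_assoc, ← Matrix.mul_assoc, Matrix.trace_mul_comm]
  simp only [Matrix.mul_assoc]

omit [DecidableEq n] in
theorem conjBy_isHermitian (U : Matrix n n ℂ) {X : Matrix n n ℂ} (hX : X.IsHermitian) :
    (conjBy U X).IsHermitian :=
  Matrix.isHermitian_mul_mul_conjTranspose U hX

theorem commute_conjBy {U : Matrix n n ℂ} (hU : U ∈ Matrix.unitaryGroup n ℂ)
    {X Y : Matrix n n ℂ} (h : Commute X Y) : Commute (conjBy U X) (conjBy U Y) :=
  h.map (Unitary.conjStarAlgAut ℂ (Matrix n n ℂ) ⟨U, hU⟩)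

/-- The dual of a covariant map is covariant. -/
theorem krausMap_dual_conjBy {U : Matrix n n ℂ} (hU : U ∈ Matrix.unitaryGroup n ℂ)
    {L : κ → Matrix n n ℂ} (hcov : ∀ X, krausMap L (conjBy U X) = conjBy U (krausMap L X))
    (Y : Matrix n n ℂ) :
    krausMap (fun j => (L j)ᴴ) (conjBy U Y) = conjBy U (krausMap (fun j => (L j)ᴴ) Y) := by
  rw [Matrix.ext_iff_trace_mul_left]
  intro X
  rw [← trace_krausMap_mul, trace_mul_conjBy, trace_mul_conjBy, ← trace_krausMap_mul]
  congr 2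
  rw [← conjBy_conjTranspose_conjBy hU (krausMap L (conjBy Uᴴ X)), ← hcov,
    conjBy_conjBy_conjTranspose hU]

/-- **No broadcasting of asymmetry**: if a covariant quantum operation leaves the state `ρ` of the
first factor invariant, then the marginal of its output on the second factor is symmetric. -/
theorem isSymmetric_complementMap_of_fixed {G : Type*} [TopologicalSpace G] [PreconnectedSpace G]
    {U : G → Matrix n n ℂ} (hU : ∀ g, U g ∈ Matrix.unitaryGroup n ℂ)
    (hcont : ∀ X, Continuous fun g => conjBy (U g) X) {e : G} (he : ∀ X, conjBy (U e) X = X)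
    {V : G → Matrix s s ℂ} {L : κ × s → Matrix n n ℂ} (hL : ∑ j, (L j)ᴴ * L j = 1)
    (hcov : IsCovariant U (krausMap L))
    (hcov' : ∀ g X, complementMap L (conjBy (U g) X) = conjBy (V g) (complementMap L X))
    {ρ : Matrix n n ℂ} (hρ : ρ.PosSemidef) (hfix : krausMap L ρ = ρ) :
    IsSymmetric V (complementMap L ρ) := by
  obtain ⟨τ, c, hτ, hτfix, hdom, hτU⟩ := exists_dominating_invariant hU hL hcov hρ hfix
  obtain ⟨P, hP, hP2, hPτ, hsupp, hPcomm⟩ := exists_support_projection hτ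
  have hQτ : (1 - P) * τ = 0 := by rw [sub_mul, one_mul, hPτ, sub_self]
  have hτP : τ * P = τ := by
    have := congrArg Matrix.conjTranspose hPτ
    rwa [Matrix.conjTranspose_mul, hP, hτ.isHermitian] at this
  -- The Kraus operators preserve the support of the invariant `τ`: the part leaking into its
  -- complement has total weight `tr ((1 - P) τ (1 - P)) = 0`.
  have hPLP : ∀ j, P * (L j * P) = L j * P := fun j => by
    have htr : ∑ j, ((1 - P) * L j * τ * ((1 - P) * L j)ᴴ).trace = 0 := by
      have h1 : ∑ j, (1 - P) * L j * τ * ((1 - P) * L j)ᴴ =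
          (1 - P) * krausMap L τ * (1 - P)ᴴ := by
        simp only [krausMap_apply, Finset.mul_sum, Finset.sum_mul, Matrix.conjTranspose_mul,
          Matrix.mul_assoc]
      rw [← Matrix.trace_sum, h1, hτfix, hQτ, zero_mul, Matrix.trace_zero]
    have := hsupp _ (mul_eq_zero_of_sum_trace_eq_zero hτ htr j)
    rw [sub_mul, sub_mul, one_mul, sub_eq_zero, mul_assoc] at this
    exact this.symm
  -- Compressing `ρ ≤ c • τ` by `1 - P` forces the compression of `ρ` to vanish.
  have hPρ : P * ρ = ρ := by
    have h1 := (hdom.mul_mul_conjTranspose_same (1 - P)).trace_nonneg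
    rw [mul_sub, mul_smul_comm, hQτ, smul_zero, zero_sub, neg_mul, Matrix.trace_neg,
      Left.nonneg_neg_iff] at h1
    have h2 := mul_eq_zero_of_trace_eq_zero hρ
      (le_antisymm h1 (hρ.mul_mul_conjTranspose_same (1 - P)).trace_nonneg)
    rw [sub_mul, one_mul, sub_eq_zero] at h2
    exact h2.symm
  have hUP : ∀ g, Commute (U g) P := fun g => hPcomm _ (by
    have h : (U g)ᴴ * U g = 1 := Matrix.mem_unitaryGroup_iff'.mp (hU g)
    have := congrArg (· * U g) (hτU g)
    show U g * τ = τ * U g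
    simpa only [conjBy, Matrix.mul_assoc, h, mul_one] using this)
  have hUP' : ∀ g, Commute (U g)ᴴ P := fun g => by
    have := congrArg Matrix.conjTranspose (hUP g).eq
    rw [Matrix.conjTranspose_mul, Matrix.conjTranspose_mul, hP] at this
    exact this.symm
  set L' : κ × s → Matrix n n ℂ := fun j => L j * P with hL'
  have hkraus : ∀ X, krausMap L' X = krausMap L (P * X * P) := fun X => by
    simp only [hL', krausMap_apply, Matrix.conjTranspose_mul, hP, Matrix.mul_assoc]
  have hcompl : ∀ X, complementMap L' X = complementMap L (P * X * P) := fun X => by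
    ext a b
    simp only [hL', complementMap, Matrix.of_apply, Matrix.conjTranspose_mul, hP,
      Matrix.mul_assoc]
  have hcorner : ∀ g X, P * conjBy (U g) X * P = conjBy (U g) (P * X * P) := fun g X => by
    simp only [conjBy]
    calc P * (U g * X * (U g)ᴴ) * P = (P * U g) * X * ((U g)ᴴ * P) := by
          simp only [Matrix.mul_assoc]
      _ = U g * (P * X * P) * (U g)ᴴ := by
          rw [← (hUP g).eq, (hUP' g).eq]; simp only [Matrix.mul_assoc]
  have hcovL' : ∀ g X, krausMap L' (conjBy (U g) X) = conjBy (U g) (krausMap L' X) :=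
    fun g X => by rw [hkraus, hkraus, hcorner, hcov]
  have hsum : ∑ j, (L' j)ᴴ * L' j = P := by
    have h1 : ∀ j, (L' j)ᴴ * L' j = P * ((L j)ᴴ * L j) * P := fun j => by
      simp only [hL', Matrix.conjTranspose_mul, hP, Matrix.mul_assoc]
    simp only [h1]
    rw [← Finset.sum_mul, ← Finset.mul_sum, hL, mul_one, hP2]
  have hL'P : ∀ j, L' j * P = L' j := fun j => by rw [hL', mul_assoc, hP2]
  have hτfix' : krausMap L' τ = τ := by rw [hkraus, hPτ, hτP, hτfix]
  have hcorner_state : ∀ g, P * conjBy (U g) ρ * P = conjBy (U g) ρ := fun g => by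
    have hρP : ρ * P = ρ := by
      have := congrArg Matrix.conjTranspose hPρ
      rwa [Matrix.conjTranspose_mul, hP, hρ.isHermitian] at this
    rw [hcorner, hPρ, hρP]
  have hstate_fix : ∀ g, krausMap L' (conjBy (U g) ρ) = conjBy (U g) ρ := fun g => by
    rw [hkraus, hcorner_state, hcov, hfix]
  intro g
  -- The defect of symmetry serves as its own witness observable: it will be shown to have the same
  -- expectation in both states of which it is the difference.
  set A := conjBy (V g) (complementMap L ρ) - complementMap L ρ with hAdef
  have hΓ : (complementMap L ρ).IsHermitian := by
    rw [Matrix.IsHermitian, complementMap_conjTranspose, hρ.isHermitian]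
  have hA : A.IsHermitian := (conjBy_isHermitian _ hΓ).sub hΓ
  set B := complementDual L' A with hBdef
  have hB : B.IsHermitian := complementDual_conjTranspose L' hA
  have hPB : P * B * P = B := by
    simp only [hBdef, complementDual, Finset.mul_sum, Finset.sum_mul, mul_smul_comm,
      smul_mul_assoc]
    refine Finset.sum_congr rfl fun j _ => Finset.sum_congr rfl fun a _ =>
      Finset.sum_congr rfl fun b _ => ?_
    rw [mul_assoc, mul_assoc, hL'P, ← mul_assoc]
    congr 2
    conv_rhs => rw [← hL'P, Matrix.conjTranspose_mul, hP]
  -- `B` is a combination of the products `(L' (j, b))ᴴ * L' (j, a)`; this is where the common label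
  -- `j` of the complementary output enters.
  have hBcomm : ∀ Y, (∀ j, Commute Y (L' j)) → (∀ j, Commute Y (L' j)ᴴ) → Commute B Y :=
    fun Y h h' => Commute.sum_left _ _ _ fun j _ => Commute.sum_left _ _ _ fun a _ =>
      Commute.sum_left _ _ _ fun b _ =>
        (((h' (j, b)).mul_right (h (j, a))).smul_right _).symm
  obtain ⟨X, hX, hPX, hXfix, hXcomm, hXtr⟩ := exists_dual_fixed hP hP2 hL'P hPLP hsum hB hPB hBcomm
  have hXcomm' : ∀ Y : Matrix n n ℂ, Y.IsHermitian → P * Y = Y →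
      krausMap (fun j => (L' j)ᴴ) Y = Y → Commute X Y := fun Y hY hPY hYfix => by
    have h := commute_of_dual_fixed hP hL'P hsum hτ hτfix' hsupp hY hPY hYfix
    refine hXcomm Y h fun j => ?_
    have := Commute.star_star (h j)
    rwa [show star Y = Y from hY] at this
  -- After conjugation by `(U g)ᴴ` the claim is that `X` commutes with `(U g)ᴴ * U h * X * (U h)ᴴ *
  -- U g`, which by covariance of the dual map is again a Hermitian fixed point in the corner.
  have hXcomm_conj : ∀ g h, Commute (conjBy (U g) X) (conjBy (U h) X) := fun g h => by
    rw [← conjBy_conjBy_conjTranspose (hU g) (conjBy (U h) X)]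
    refine commute_conjBy (hU g) (hXcomm' _ ?_ ?_ ?_)
    · exact conjBy_isHermitian _ (conjBy_isHermitian _ hX)
    · have hPX' : P * X = X := by rw [← hPX, ← mul_assoc, ← mul_assoc, hP2]
      simp only [conjBy, Matrix.conjTranspose_conjTranspose]
      rw [← mul_assoc, ← mul_assoc, ← (hUP' g).eq, mul_assoc (U g)ᴴ P, ← mul_assoc P,
        ← mul_assoc P, ← (hUP h).eq, mul_assoc (U h) P, hPX']
    · have h1 := krausMap_dual_conjBy (hU g) (hcovL' g) (conjBy (U g)ᴴ (conjBy (U h) X))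
      rw [conjBy_conjBy_conjTranspose (hU g), krausMap_dual_conjBy (hU h) (hcovL' h), hXfix] at h1
      conv_rhs => rw [h1, conjBy_conjTranspose_conjBy (hU g)]
  have hXsymm : ∀ g, conjBy (U g) X = X := fun g => by
    rw [conjBy_eq_of_commute hU hcont hX hXcomm_conj g e, he]
  -- Translates of `ρ` are also fixed states, so `B` may be replaced by `X` in their expectation,
  -- and the symmetry of `X` removes `h`.
  have hexp : ∀ h, (A * complementMap L (conjBy (U h) ρ)).trace = (X * ρ).trace := fun h => by
    rw [← hcorner_state h, ← hcompl, trace_mul_complementMap, ← hBdef, ← hXtr _ (hstate_fix h),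
      trace_mul_conjBy]
    conv_lhs => rw [← hXsymm h, conjBy_conjTranspose_conjBy (hU h)]
  have hzero : (Aᴴ * A).trace = 0 := by
    have h1 := hexp g
    have h2 := hexp e
    rw [hcov'] at h1
    rw [he] at h2
    rw [hA.eq]
    conv_lhs => rw [hAdef, ← hAdef, mul_sub]
    rw [Matrix.trace_sub, h1, h2, sub_self]
  exact sub_eq_zero.mp (Matrix.trace_conjTranspose_mul_self_eq_zero_iff.mp hzero)
end
-- Choi's theorem and the reduction to Kraus families on `R`
section
variable {κ r s n : Type*} [Fintype κ] [Fintype r] [Fintype s] [Fintype n]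

theorem sum_conjTranspose_mul_self_eq_one [DecidableEq n] {m : Type*} [Fintype m]
    {L : κ → Matrix m n ℂ}
    (h : ∀ X, (krausMap L X).trace = X.trace) : ∑ j, (L j)ᴴ * L j = 1 := by
  rw [Matrix.ext_iff_trace_mul_left]
  intro X
  rw [← trace_krausMap, h, mul_one]

/-- **Choi's theorem**: a quantum channel has a Kraus decomposition. -/
theorem IsChannel.exists_krausMap [DecidableEq n] {E : Matrix n n ℂ →ₗ[ℂ] Matrix n n ℂ}
    (hE : IsChannel E) : ∃ K : n × Fin (Fintype.card n) → Matrix n n ℂ,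
      ∑ j, (K j)ᴴ * K j = 1 ∧ E = krausMap K := by
  let e := Fintype.equivFin n
  -- The unnormalized maximally entangled vector; the columns of a factor `C` of its Choi matrix,
  -- reshaped, are the Kraus operators.
  let v : n × Fin (Fintype.card n) → ℂ := fun p => if e p.1 = p.2 then 1 else 0
  obtain ⟨C, hC⟩ := exists_eq_mul_conjTranspose
    (hE.1 _ _ (Matrix.posSemidef_vecMulVec_self_star v))
  let K : n × Fin (Fintype.card n) → Matrix n n ℂ := fun a => Matrix.of fun i p => C (i, e p) a
  have hsingle : ∀ p q i j, E (Matrix.single p q 1) i j = ∑ a, K a i p * star (K a j q) :=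
    fun p q i j => by
      have h1 := congrFun (congrFun hC (i, e p)) (j, e q)
      have h2 : (Matrix.of fun i j =>
          Matrix.vecMulVec v (star v) (i, e p) (j, e q)) = Matrix.single p q (1 : ℂ) := by
        ext i j
        simp [v, Matrix.vecMulVec_apply, Matrix.single_apply, eq_comm, ite_and]
        split_ifs <;> rfl
      simp only [ampliation, Matrix.of_apply] at h1
      rw [h2] at h1
      rw [h1, Matrix.mul_apply]
      rfl
  have hEK : E = krausMap K := by
    refine LinearMap.ext fun X => ?_
    ext i j
    conv_lhs => rw [Matrix.matrix_eq_sum_single X]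
    simp only [map_sum, Matrix.sum_apply, krausMap_apply]
    have h1 : ∀ p q, E (Matrix.single p q (X p q)) i j =
        ∑ a, K a i p * X p q * star (K a j q) := fun p q => by
      have : Matrix.single p q (X p q) = X p q • Matrix.single p q (1 : ℂ) := by simp
      rw [this, map_smul, Matrix.smul_apply, hsingle, smul_eq_mul, Finset.mul_sum]
      exact Finset.sum_congr rfl fun a _ => by ring
    simp only [h1, Matrix.mul_apply, Finset.sum_mul, Matrix.conjTranspose_apply]
    rw [Finset.sum_comm]
    conv_rhs => rw [Finset.sum_comm]
    exact Finset.sum_congr rfl fun q _ => Finset.sum_comm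
  refine ⟨K, sum_conjTranspose_mul_self_eq_one fun X => ?_, hEK⟩
  rw [← hEK, hE.2]

theorem isChannel_krausMap [DecidableEq n] {L : κ → Matrix n n ℂ}
    (hL : ∑ j, (L j)ᴴ * L j = 1) : IsChannel (krausMap L) := by
  refine ⟨fun k X hX => ?_, fun X => by rw [trace_krausMap, hL, mul_one]⟩
  have : ampliation k (krausMap L) X =
      krausMap (fun j => L j ⊗ₖ (1 : Matrix (Fin k) (Fin k) ℂ)) X := by
    ext ⟨i, p⟩ ⟨j, q⟩
    simp only [ampliation, Matrix.of_apply, krausMap_apply, Matrix.sum_apply]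
    refine Finset.sum_congr rfl fun a _ => ?_
    simp [Matrix.mul_apply, Fintype.sum_prod_type, Matrix.one_apply,
      apply_ite (starRingEnd ℂ)]
  rw [this]
  exact krausMap_posSemidef _ hX

theorem IsChannel.comp {E F : Matrix n n ℂ →ₗ[ℂ] Matrix n n ℂ} (hE : IsChannel E)
    (hF : IsChannel F) : IsChannel (E ∘ₗ F) :=
  ⟨fun k X hX => hE.1 k _ (hF.1 k X hX), fun X => (hE.2 _).trans (hF.2 X)⟩

theorem isChannel_id : IsChannel (LinearMap.id : Matrix n n ℂ →ₗ[ℂ] Matrix n n ℂ) :=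
  ⟨fun _ _ hX => hX, fun _ => rfl⟩

/-- A channel on `R ⊗ S`, applied to `X ⊗ ρS`, has Kraus operators on `R` labelled by the basis
of `S`. -/
theorem IsChannel.exists_kraus_kronecker [DecidableEq r] [DecidableEq s]
    {E : Matrix (r × s) (r × s) ℂ →ₗ[ℂ] Matrix (r × s) (r × s) ℂ} (hE : IsChannel E)
    {ρS : Matrix s s ℂ} (hρ : IsState ρS) :
    ∃ K : (((r × s) × Fin (Fintype.card (r × s))) × s) × s → Matrix r r ℂ,
      ∑ j, (K j)ᴴ * K j = 1 ∧ (∀ X, krausMap K X = traceS (E (X ⊗ₖ ρS))) ∧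
      ∀ X, complementMap K X = traceR (E (X ⊗ₖ ρS)) := by
  obtain ⟨K, -, hK⟩ := hE.exists_krausMap
  obtain ⟨C, hC⟩ := exists_eq_mul_conjTranspose hρ.1
  -- `W c` appends the `c`-th column of `C`, so the `W c` are Kraus operators for `X ↦ X ⊗ₖ ρS`.
  -- Below, `K'` reads off the rows of `K * W` with a given `S`-coordinate.
  let W : s → Matrix (r × s) r ℂ := fun c => Matrix.of fun p k => if p.1 = k then C p.2 c else 0
  have hW : ∀ X : Matrix r r ℂ, X ⊗ₖ ρS = ∑ c, W c * X * (W c)ᴴ := fun X => by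
    ext ⟨k, l⟩ ⟨k', l'⟩
    simp only [hC, Matrix.kroneckerMap_apply, Matrix.sum_apply, Matrix.mul_apply,
      Matrix.conjTranspose_apply, W, Matrix.of_apply, Finset.mul_sum]
    refine Finset.sum_congr rfl fun c _ => ?_
    simp [apply_ite (starRingEnd ℂ)]
    ring
  let K' : (((r × s) × Fin (Fintype.card (r × s))) × s) × s → Matrix r r ℂ :=
    fun j => (K j.1.1 * W j.1.2).submatrix (fun i => (i, j.2)) id
  have hentry : ∀ X i i' t t', E (X ⊗ₖ ρS) (i, t) (i', t') =
      ∑ a, (K' (a, t) * X * (K' (a, t'))ᴴ) i i' := fun X i i' t t' => by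
    have h1 : E (X ⊗ₖ ρS) = ∑ a : ((r × s) × Fin (Fintype.card (r × s))) × s,
        (K a.1 * W a.2) * X * (K a.1 * W a.2)ᴴ := by
      rw [hK, hW, krausMap_apply]
      simp only [Fintype.sum_prod_type, Matrix.mul_sum, Matrix.sum_mul, Matrix.conjTranspose_mul, Matrix.mul_assoc]
    rw [h1, Matrix.sum_apply]
    refine Finset.sum_congr rfl fun a _ => ?_
    rfl
  have hS : ∀ X, krausMap K' X = traceS (E (X ⊗ₖ ρS)) := fun X => by
    ext i i'
    simp only [traceS, Matrix.of_apply, hentry, krausMap_apply, Matrix.sum_apply]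
    rw [Fintype.sum_prod_type, Finset.sum_comm]
  have hR : ∀ X, complementMap K' X = traceR (E (X ⊗ₖ ρS)) := fun X => by
    ext t t'
    simp only [traceR, Matrix.of_apply, hentry, complementMap, Matrix.trace, Matrix.diag_apply]
    rw [Finset.sum_comm]
  refine ⟨K', sum_conjTranspose_mul_self_eq_one fun X => ?_, hS, hR⟩
  have h1 : (traceS (E (X ⊗ₖ ρS))).trace = (E (X ⊗ₖ ρS)).trace := by
    simp [traceS, Matrix.trace, Fintype.sum_prod_type]
  rw [hS, h1, hE.2, Matrix.trace_kronecker, hρ.2, mul_one]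

theorem trace_mul_traceS [DecidableEq s] (A : Matrix r r ℂ) (Z : Matrix (r × s) (r × s) ℂ) :
    (A * traceS Z).trace = ((A ⊗ₖ (1 : Matrix s s ℂ)) * Z).trace := by
  simp only [Matrix.trace, Matrix.diag_apply, Matrix.mul_apply, traceS, Matrix.of_apply,
    Fintype.sum_prod_type, Matrix.kroneckerMap_apply, Matrix.one_apply, mul_ite, mul_one, mul_zero,
    ite_mul, zero_mul, Finset.sum_ite_eq, Finset.mem_univ, if_true, Finset.mul_sum]
  refine Finset.sum_congr rfl fun i _ => Finset.sum_comm

theorem trace_mul_traceR [DecidableEq r] (A : Matrix s s ℂ) (Z : Matrix (r × s) (r × s) ℂ) :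
    (A * traceR Z).trace = (((1 : Matrix r r ℂ) ⊗ₖ A) * Z).trace := by
  simp only [Matrix.trace, Matrix.diag_apply, Matrix.mul_apply, traceR, Matrix.of_apply,
    Fintype.sum_prod_type, Matrix.kroneckerMap_apply, Matrix.one_apply, one_mul,
    ite_mul, zero_mul, Finset.mul_sum]
  have h1 : ∀ (i : r) (b : s), ∑ i', ∑ a, (if i = i' then A b a * Z (i', a) (i, b) else 0) =
      ∑ a, A b a * Z (i, a) (i, b) := fun i b => by
    rw [Finset.sum_comm]; simp
  simp only [h1]
  conv_rhs => rw [Finset.sum_comm]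
  exact Finset.sum_congr rfl fun b _ => Finset.sum_comm

theorem conjBy_kronecker (U X : Matrix r r ℂ) (V Y : Matrix s s ℂ) :
    conjBy (U ⊗ₖ V) (X ⊗ₖ Y) = conjBy U X ⊗ₖ conjBy V Y := by
  simp only [conjBy, Matrix.conjTranspose_kronecker, ← Matrix.mul_kronecker_mul]

theorem conjBy_conjTranspose_one [DecidableEq n] {U : Matrix n n ℂ}
    (hU : U ∈ Matrix.unitaryGroup n ℂ) : conjBy Uᴴ 1 = 1 := by
  rw [conjBy, mul_one, Matrix.conjTranspose_conjTranspose]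
  exact Matrix.mem_unitaryGroup_iff'.mp hU

/-- Tested against `A`, the partial trace becomes pairing with `A ⊗ₖ 1`, and conjugation by a
unitary fixes the factor `1`. -/
theorem traceS_conjBy [DecidableEq s] (U : Matrix r r ℂ) {V : Matrix s s ℂ}
    (hV : V ∈ Matrix.unitaryGroup s ℂ) (Z : Matrix (r × s) (r × s) ℂ) :
    traceS (conjBy (U ⊗ₖ V) Z) = conjBy U (traceS Z) := by
  classical
  rw [Matrix.ext_iff_trace_mul_left]
  intro A
  rw [trace_mul_traceS, trace_mul_conjBy, trace_mul_conjBy, trace_mul_traceS,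
    Matrix.conjTranspose_kronecker, conjBy_kronecker, conjBy_conjTranspose_one hV]

theorem traceR_conjBy [DecidableEq r] {U : Matrix r r ℂ} (V : Matrix s s ℂ)
    (hU : U ∈ Matrix.unitaryGroup r ℂ) (Z : Matrix (r × s) (r × s) ℂ) :
    traceR (conjBy (U ⊗ₖ V) Z) = conjBy V (traceR Z) := by
  classical
  rw [Matrix.ext_iff_trace_mul_left]
  intro A
  rw [trace_mul_traceR, trace_mul_conjBy, trace_mul_conjBy, trace_mul_traceR,
    Matrix.conjTranspose_kronecker, conjBy_kronecker, conjBy_conjTranspose_one hU]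
end
-- Compactness of Kraus families and passage to the limit
section
variable {κ ι r s : Type*} [Fintype κ] [Fintype ι] [Fintype r] [Fintype s] [DecidableEq r]

instance instFirstCountableTopologyMatrix {m n : Type*} [Finite m] [Finite n] :
    FirstCountableTopology (Matrix m n ℂ) :=
  inferInstanceAs (FirstCountableTopology (m → n → ℂ))

/-- The `(k, k)` entry of the normalization says that the squared moduli in the `k`-th columns of
all the `L j` sum to one, so every entry is bounded by one. -/
theorem isCompact_kraus : IsCompact {L : κ → Matrix r r ℂ | ∑ j, (L j)ᴴ * L j = 1} := by
  refine (isCompact_univ_pi fun _ : κ => isCompact_norm_apply_le (m := r) (n := r) 1)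
    |>.of_isClosed_subset (isClosed_eq (by fun_prop) continuous_const) fun L hL j _ i k => ?_
  have h1 := congrArg Complex.re (congrFun (congrFun hL k) k)
  have h2 : ∀ j, (((L j)ᴴ * L j) k k).re = ∑ i, ‖L j i k‖ ^ 2 := fun j => by
    rw [Matrix.mul_apply, Complex.re_sum]
    refine Finset.sum_congr rfl fun i _ => ?_
    rw [Matrix.conjTranspose_apply, RCLike.star_def, mul_comm, Complex.mul_conj,
      Complex.normSq_eq_norm_sq, Complex.ofReal_re]
  rw [Matrix.sum_apply, Complex.re_sum, Matrix.one_apply_eq, Complex.one_re] at h1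
  simp only [h2] at h1
  have h3 : ‖L j i k‖ ^ 2 ≤ 1 := by
    rw [← h1]
    exact (Finset.single_le_sum (f := fun i => ‖L j i k‖ ^ 2) (fun _ _ => by positivity)
      (Finset.mem_univ i)).trans (Finset.single_le_sum (f := fun j => ∑ i, ‖L j i k‖ ^ 2)
        (fun _ _ => Finset.sum_nonneg fun _ _ => by positivity) (Finset.mem_univ j))
  exact (sq_le_one_iff₀ (norm_nonneg _)).mp h3

omit [DecidableEq r] in
theorem continuous_krausMap :
    Continuous fun p : (κ → Matrix r r ℂ) × Matrix r r ℂ => krausMap p.1 p.2 := by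
  simp only [krausMap_apply]
  fun_prop

omit [Fintype s] [DecidableEq r] in
theorem continuous_complementMap :
    Continuous fun p : (κ × s → Matrix r r ℂ) × Matrix r r ℂ => complementMap p.1 p.2 := by
  refine continuous_matrix fun a b => ?_
  simp only [complementMap, Matrix.of_apply]
  fun_prop

/-- Kraus operators of a channel on the first factor that is applied after the family `K`. -/
def krausComp (T : ι → Matrix r r ℂ) (K : κ × s → Matrix r r ℂ) :
    (ι × κ) × s → Matrix r r ℂ :=
  fun j => T j.1.1 * K (j.1.2, j.2)

omit [DecidableEq r] in
theorem krausMap_krausComp (T : ι → Matrix r r ℂ) (K : κ × s → Matrix r r ℂ) (X : Matrix r r ℂ) :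
    krausMap (krausComp T K) X = krausMap T (krausMap K X) := by
  simp only [krausMap_apply, krausComp, Fintype.sum_prod_type, Matrix.mul_sum, Matrix.sum_mul,
    Matrix.conjTranspose_mul, Matrix.mul_assoc]

-- No signalling: a trace-preserving operation performed on `R` afterwards leaves the marginal of
-- `S` untouched.
omit [Fintype s] in
theorem complementMap_krausComp {T : ι → Matrix r r ℂ} (hT : ∑ j, (T j)ᴴ * T j = 1)
    (K : κ × s → Matrix r r ℂ) (X : Matrix r r ℂ) :
    complementMap (krausComp T K) X = complementMap K X := by
  ext a b
  simp only [complementMap, krausComp, Matrix.of_apply, Fintype.sum_prod_type]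
  rw [Finset.sum_comm]
  refine Finset.sum_congr rfl fun j _ => ?_
  have h1 : ∀ i, (T i * K (j, a) * X * (T i * K (j, b))ᴴ).trace =
      ((T i)ᴴ * T i * (K (j, a) * X * (K (j, b))ᴴ)).trace := fun i => by
    rw [Matrix.mul_assoc (T i)ᴴ, Matrix.trace_mul_comm (T i)ᴴ]
    simp only [Matrix.conjTranspose_mul, Matrix.mul_assoc]
  simp only [h1]
  rw [← Matrix.trace_sum, ← Finset.sum_mul, hT, one_mul]

omit [DecidableEq r] in
/-- If any two terms `ρ n`, `ρ m`, `n < m`, of a sequence of states are related by a Kraus family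
from a compact set with complementary output `σ`, then some state is related to itself. -/
theorem exists_fixed_of_transitions {C : Set (κ × s → Matrix r r ℂ)} (hC : IsCompact C)
    {ρ : ℕ → Matrix r r ℂ} (hρ : ∀ n, IsState (ρ n)) {σ : Matrix s s ℂ}
    (h : ∀ n m, n < m → ∃ L ∈ C, krausMap L (ρ n) = ρ m ∧ complementMap L (ρ n) = σ) :
    ∃ L ∈ C, ∃ τ, IsState τ ∧ krausMap L τ = τ ∧ complementMap L τ = σ := by
  obtain ⟨τ, hτ, φ, hφ, hlim⟩ := isCompact_isState.tendsto_subseq hρ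
  -- Consecutive terms of the convergent subsequence are linked, so input and output states share
  -- the limit `τ`.
  choose L hLC hL hL' using fun k => h (φ k) (φ (k + 1)) (hφ k.lt_succ_self)
  obtain ⟨M, hM, ψ, hψ, hlim'⟩ := hC.tendsto_subseq hLC
  have hpair : Filter.Tendsto (fun k => (L (ψ k), ρ (φ (ψ k)))) Filter.atTop (nhds (M, τ)) :=
    hlim'.prodMk_nhds (hlim.comp hψ.tendsto_atTop)
  refine ⟨M, hM, τ, hτ, ?_, ?_⟩
  · refine tendsto_nhds_unique (((continuous_krausMap (κ := κ × s) (r := r)).tendsto (M, τ)).comp hpair) ?_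
    have : (fun p : (κ × s → Matrix r r ℂ) × Matrix r r ℂ => krausMap p.1 p.2) ∘
        (fun k => (L (ψ k), ρ (φ (ψ k)))) = (ρ ∘ φ) ∘ (fun k => ψ k + 1) :=
      funext fun k => hL (ψ k)
    rw [this]
    exact hlim.comp ((Filter.tendsto_add_atTop_nat 1).comp hψ.tendsto_atTop)
  · refine tendsto_nhds_unique
      (((continuous_complementMap (κ := κ) (s := s) (r := r)).tendsto (M, τ)).comp hpair) ?_
    exact tendsto_const_nhds.congr fun k => (hL' (ψ k)).symm

/-- Covariance is imposed on the induced maps, not on individual Kraus operators, as closed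
conditions for each `g` and `X`; it therefore survives the limit. -/
theorem isCompact_covariant_kraus {G : Type*} (U : G → Matrix r r ℂ) (V : G → Matrix s s ℂ) :
    IsCompact {L : κ × s → Matrix r r ℂ | ∑ j, (L j)ᴴ * L j = 1 ∧
      IsCovariant U (krausMap L) ∧
      ∀ g X, complementMap L (conjBy (U g) X) = conjBy (V g) (complementMap L X)} := by
  have h1 : ∀ X : Matrix r r ℂ, Continuous fun L : κ × s → Matrix r r ℂ => krausMap L X :=
    fun X => by simp only [krausMap_apply]; fun_prop
  have h2 : ∀ X : Matrix r r ℂ, Continuous fun L : κ × s → Matrix r r ℂ => complementMap L X :=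
    fun X => continuous_matrix fun a b => by
      simp only [complementMap, Matrix.of_apply]; fun_prop
  have hclosed1 : IsClosed {L : κ × s → Matrix r r ℂ | IsCovariant U (krausMap L)} := by
    simp only [IsCovariant, Set.ofPred_forall]
    refine isClosed_iInter fun g => isClosed_iInter fun X => isClosed_eq (h1 _) ?_
    exact (by unfold conjBy; fun_prop : Continuous fun Z => conjBy (U g) Z).comp (h1 X)
  have hclosed2 : IsClosed {L : κ × s → Matrix r r ℂ |
      ∀ g X, complementMap L (conjBy (U g) X) = conjBy (V g) (complementMap L X)} := by
    simp only [Set.ofPred_forall]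
    refine isClosed_iInter fun g => isClosed_iInter fun X => isClosed_eq (h2 _) ?_
    exact (by unfold conjBy; fun_prop : Continuous fun Z => conjBy (V g) Z).comp (h2 X)
  exact isCompact_kraus.inter_right (hclosed1.inter hclosed2)

variable [DecidableEq s]

/-- Weak broadcasting is impossible for a connected family of unitaries. -/
theorem isSymmetric_of_broadcast {G : Type*} [TopologicalSpace G] [PreconnectedSpace G]
    {U : G → Matrix r r ℂ} (hU : ∀ g, U g ∈ Matrix.unitaryGroup r ℂ)
    (hcont : ∀ X, Continuous fun g => conjBy (U g) X) {e : G} (he : ∀ X, conjBy (U e) X = X)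
    {V : G → Matrix s s ℂ} (hV : ∀ g, V g ∈ Matrix.unitaryGroup s ℂ)
    {ρS ρS' : Matrix s s ℂ} (hρS : IsState ρS) (hsymm : IsSymmetric V ρS)
    {E : ℕ → Matrix (r × s) (r × s) ℂ →ₗ[ℂ] Matrix (r × s) (r × s) ℂ}
    (hE : ∀ n, IsChannel (E n) ∧ IsCovariant (fun g => U g ⊗ₖ V g) (E n))
    {ρR : ℕ → Matrix r r ℂ} (hρR : ∀ n, IsState (ρR n))
    (hjoint : ∀ n, IsJoint (E n (ρR n ⊗ₖ ρS)) (ρR (n + 1)) ρS') : IsSymmetric V ρS' := by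
  choose K hKsum hKS hKR using fun n => (hE n).1.exists_kraus_kronecker hρS
  have hcovE : ∀ n g X, E n (conjBy (U g) X ⊗ₖ ρS) =
      conjBy (U g ⊗ₖ V g) (E n (X ⊗ₖ ρS)) := fun n g X => by
    rw [← (hE n).2 g, conjBy_kronecker, hsymm g]
  have hKcov : ∀ n, IsCovariant U (krausMap (K n)) := fun n g X => by
    rw [hKS, hKS, hcovE, traceS_conjBy _ (hV g)]
  have hKcov' : ∀ n g X, complementMap (K n) (conjBy (U g) X) =
      conjBy (V g) (complementMap (K n) X) := fun n g X => by
    rw [hKR, hKR, hcovE, traceR_conjBy _ (hU g)]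
  have hstep : ∀ n, krausMap (K n) (ρR n) = ρR (n + 1) := fun n => by
    rw [hKS]; exact (hjoint n).1
  have hchain : ∀ n m, ∃ Θ : Matrix r r ℂ →ₗ[ℂ] Matrix r r ℂ, IsChannel Θ ∧ IsCovariant U Θ ∧
      Θ (ρR n) = ρR (n + m) := fun n m => by
    induction m with
    | zero => exact ⟨LinearMap.id, isChannel_id, fun _ _ => rfl, rfl⟩
    | succ m ih =>
      obtain ⟨Θ, h1, h2, h3⟩ := ih
      refine ⟨krausMap (K (n + m)) ∘ₗ Θ, (isChannel_krausMap (hKsum _)).comp h1, fun g X => ?_, ?_⟩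
      · rw [LinearMap.comp_apply, h2, hKcov, LinearMap.comp_apply]
      · rw [LinearMap.comp_apply, h3, hstep, add_assoc]
  -- The Kraus label type `κ` does not depend on `n` and `m`, since Choi's theorem bounds the number
  -- of Kraus operators however many rounds are composed.
  obtain ⟨L, ⟨hL, hcov, hcov'⟩, τ, hτ, hfix, hout⟩ :=
      exists_fixed_of_transitions (σ := ρS') (isCompact_covariant_kraus
        (κ := (r × Fin (Fintype.card r)) × (((r × s) × Fin (Fintype.card (r × s))) × s)) U V) hρR fun n m hnm => by
    obtain ⟨k, rfl⟩ := Nat.exists_eq_add_of_lt hnm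
    -- Only round `n` emits the retained copy of `ρS'`; `Θ` then carries `ρR (n + 1)` through the
    -- `k` remaining rounds, with `k = 0` allowed.
    obtain ⟨Θ, h1, h2, h3⟩ := hchain (n + 1) k
    obtain ⟨T, hT, rfl⟩ := h1.exists_krausMap
    refine ⟨krausComp T (K n), ⟨?_, fun g X => ?_, fun g X => ?_⟩, ?_, ?_⟩
    · refine sum_conjTranspose_mul_self_eq_one fun X => ?_
      rw [krausMap_krausComp, trace_krausMap, hT, mul_one, trace_krausMap, hKsum, mul_one]
    · rw [krausMap_krausComp, krausMap_krausComp, hKcov, h2]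
    · rw [complementMap_krausComp hT, complementMap_krausComp hT, hKcov']
    · rw [krausMap_krausComp, hstep, h3]
      congr 1; omega
    · rw [complementMap_krausComp hT, hKR]
      exact (hjoint n).2
  rw [← hout]
  exact isSymmetric_complementMap_of_fixed hU hcont he hL hcov hcov' hτ.1 hfix
end

/-! ### Time translations and the identity of a projective representation -/

section TimeEvolution
variable {n : Type*} [Fintype n] [DecidableEq n]

theorem timeEvolution_mem_unitaryGroup {H : Matrix n n ℂ} (hH : H.IsHermitian) (t : ℝ) :
    timeEvolution H t ∈ Matrix.unitaryGroup n ℂ := by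
  have h1 : (timeEvolution H t)ᴴ = NormedSpace.exp (-((-(Complex.I * (t : ℂ))) • H)) := by
    rw [timeEvolution, ← Matrix.exp_conjTranspose, Matrix.conjTranspose_smul, hH.eq, ← neg_smul]
    congr 2
    simp
  rw [Matrix.mem_unitaryGroup_iff, Matrix.star_eq_conjTranspose, h1, timeEvolution,
    ← Matrix.exp_add_of_commute _ _ (Commute.refl ((-(Complex.I * (t : ℂ))) • H)).neg_right, add_neg_cancel,
    NormedSpace.exp_zero]

open scoped Matrix.Norms.L2Operator in
theorem hasDerivAt_timeEvolution (H : Matrix n n ℂ) (t : ℝ) :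
    HasDerivAt (timeEvolution H) (timeEvolution H t * (-Complex.I • H)) t := by
  have h := hasDerivAt_exp_smul_const (𝕂 := ℝ) (-Complex.I • H) t
  have h1 : timeEvolution H = fun u : ℝ => NormedSpace.exp (u • (-Complex.I • H)) := by
    funext u
    rw [timeEvolution, ← Complex.coe_smul, smul_smul]
    congr 2
    ring
  rw [h1]
  exact h

theorem continuous_timeEvolution (H : Matrix n n ℂ) : Continuous (timeEvolution H) :=
  open scoped Matrix.Norms.L2Operator in
  continuous_iff_continuousAt.mpr fun t => (hasDerivAt_timeEvolution H t).continuousAt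

theorem timeEvolution_zero (H : Matrix n n ℂ) : timeEvolution H 0 = 1 := by
  simp [timeEvolution, NormedSpace.exp_zero]

/-- Differentiating the commutation with `timeEvolution H t` at `t = 0` gives commutation with `H`;
conversely `exp` inherits commutation. -/
theorem isSymmetric_timeEvolution_iff {H : Matrix n n ℂ} (hH : H.IsHermitian)
    {ρ : Matrix n n ℂ} : IsSymmetric (timeEvolution H) ρ ↔ Commute ρ H := by
  constructor
  · intro h
    have h1 : ∀ t, timeEvolution H t * ρ = ρ * timeEvolution H t := fun t => by
      have h2 := congrArg (· * timeEvolution H t) (h t)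
      have h3 : (timeEvolution H t)ᴴ * timeEvolution H t = 1 :=
        Matrix.mem_unitaryGroup_iff'.mp (timeEvolution_mem_unitaryGroup hH t)
      simpa only [conjBy, mul_assoc, h3, mul_one] using h2
    open scoped Matrix.Norms.L2Operator in
    have h2 := (hasDerivAt_timeEvolution H 0).mul_const ρ
    open scoped Matrix.Norms.L2Operator in
    have h3 := (hasDerivAt_timeEvolution H 0).const_mul ρ
    rw [← funext h1] at h3
    have h4 := h2.unique h3
    rw [timeEvolution_zero, one_mul, smul_mul_assoc, mul_smul_comm] at h4
    exact (smul_right_injective _ (neg_ne_zero.mpr Complex.I_ne_zero) h4).symm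
  · intro h t
    have h1 : Commute ρ (timeEvolution H t) := by
      open scoped Matrix.Norms.L2Operator in
      exact (h.smul_right _).exp_right
    have h3 : timeEvolution H t * (timeEvolution H t)ᴴ = 1 :=
      Matrix.mem_unitaryGroup_iff.mp (timeEvolution_mem_unitaryGroup hH t)
    rw [conjBy, ← h1.eq, mul_assoc, h3, mul_one]

end TimeEvolution

/-- From `U 1 = c • (U 1 * U 1)` and unitarity, `c • U 1 = 1`, so `U 1` is a scalar and acts
trivially by conjugation. -/
theorem ProjUnitaryRep.conjBy_one {G n : Type*} [Group G] [TopologicalSpace G] [Fintype n]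
    [DecidableEq n] (UR : ProjUnitaryRep G n) (X : Matrix n n ℂ) : conjBy (UR.U 1) X = X := by
  obtain ⟨c, -, hc⟩ := UR.mul_phase 1 1
  have h1 : UR.U 1 * (UR.U 1)ᴴ = 1 := Matrix.mem_unitaryGroup_iff.mp (UR.unitary 1)
  have h2 : (1 : Matrix n n ℂ) = c • UR.U 1 := by
    have := congrArg (· * (UR.U 1)ᴴ) hc
    simpa only [mul_one, h1, smul_mul_assoc, mul_assoc] using this
  have h3 : Commute (UR.U 1) X := by
    have h4 : UR.U 1 = (c • UR.U 1) * UR.U 1 := by rw [← h2, one_mul]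
    have hc0 : Commute (c • UR.U 1) X := by rw [← h2]; exact Commute.one_left X
    by_cases h0 : c = 0
    · rw [h0, zero_smul, zero_mul] at h4
      rw [h4]; exact Commute.zero_left X
    · simpa [smul_smul, h0] using hc0.smul_left c⁻¹
  rw [conjBy, h3.eq, mul_assoc, h1, mul_one]

end QBroadcast

theorem theorem3 {r : Type*} [Fintype r] [DecidableEq r] :
    (∀ {V : Type*} [NormedAddCommGroup V] [NormedSpace ℝ V] [FiniteDimensional ℝ V]
      {M : Type*} [TopologicalSpace M] (I : ModelWithCorners ℝ V M)
      {G : Type*} [TopologicalSpace G] [ChartedSpace M G] [Group G] [LieGroup I ∞ G]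
      [ConnectedSpace G] (UR : QBroadcast.ProjUnitaryRep G r),
      ¬ QBroadcast.WeaklyBroadcastsAsymmetry UR) ∧
    (∀ HR : Matrix r r ℂ, HR.IsHermitian → ¬ QBroadcast.WeaklyBroadcastsCoherence HR) := by
  refine ⟨?_, ?_⟩
  · intro V _ _ _ M _ I G _ _ _ _ _ UR ⟨d, US, ρS, ρS', E, ρR, hρS, hsymm, hE, hρR, hjoint, hasymm⟩
    exact hasymm (QBroadcast.isSymmetric_of_broadcast UR.unitary UR.continuous_conj
      UR.conjBy_one US.unitary hρS hsymm hE hρR hjoint)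
  · intro HR hHR ⟨d, HS, ρS, ρS', E, ρR, hHS, hρS, hsymm, hE, hρR, hjoint, hasymm⟩
    refine hasymm ((QBroadcast.isSymmetric_timeEvolution_iff hHS).mp ?_)
    refine QBroadcast.isSymmetric_of_broadcast (e := (0 : ℝ))
      (QBroadcast.timeEvolution_mem_unitaryGroup hHR) (fun X => ?_) (fun X => ?_)
      (QBroadcast.timeEvolution_mem_unitaryGroup hHS) hρS
      ((QBroadcast.isSymmetric_timeEvolution_iff hHS).mpr hsymm) hE hρR hjoint
    · have := QBroadcast.continuous_timeEvolution HR
      simp only [QBroadcast.conjBy]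
      fun_prop
    · rw [QBroadcast.timeEvolution_zero]
      simp [QBroadcast.conjBy]
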